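/- Let $\Lambda=[a,b]\subset\mathbb Z$ be a finite interval with $|\Lambda|=b-a+1\ge 5$ sites, let $\lambda\in\mathbb C\setminus\{0\}$ and $\kappa>0$, and let $\mathcal H_\Lambda=\bigotimes_{x\in\Lambda}\mathbb C^2$ with canonical orthonormal basis $|\sigma\rangle$, $\sigma\in\{0,1\}^\Lambda$ (where $1$ means spin up, i.e. an occupied site, and $0$ spin down, i.e. a vacant site). Write $\sigma_x^{+}$, $\sigma_x^-$ for the operators acting on the site $x$ by $\sigma^+|0\rangle=|1\rangle$, $\sigma^+|1\rangle=0$ and $\sigma^-=(\sigma^+)^*$, let $n_x=\sigma_x^+\sigma_x^-=\tfrac12(\sigma_x^3+1)$ be the occupation number, let $q_x=\sigma^-_{x+1}\sigma^-_{x+2}-\lambda\,\sigma^-_x\sigma^-_{x+3}$, and let $$H_\Lambda=\sum_{x=a}^{b-2}n_xn_{x+2}+\kappa\sum_{x=a}^{b-3}q_x^*q_x .$$ Consider the following tiles, described by the particle content of the consecutive sites that they cover: the void $0$, the monomer $100$, the dimer $011000$; the left dimer $11000$ (allowed only at the left end of $\Lambda$); and, allowed only at the right end of $\Lambda$, the right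 dimer $011$, the right $1$-monomer $1$, the right $2$-monomer $10$, the truncated $1$-dimer $0110$ and the truncated $2$-dimer $01100$. A root tiling $R$ of $\Lambda$ is a tiling of $\Lambda$ by voids and monomers, where in addition the leftmost tile may be the left dimer and the rightmost tile may be the right dimer, the right $1$-monomer or the right $2$-monomer; $\mathcal R_\Lambda$ is the set of root tilings. Let $\mathcal D_\Lambda(R)$ be the set of all tilings obtained from $R$ by any number (possibly zero) of the following substitutions: two adjacent monomers are replaced by a dimer; a monomer followed by the right $j$-monomer is replaced by the truncated $j$-dimer ($j=1,2$). The VMD (void-monomer-dimer) state of $R\in\mathcal R_\Lambda$ and the VMD space are $$\psi_\Lambda(R)=\sum_{(D_1,\dots,D_N)\in\mathcal D_\Lambda(R)}\sigma_{D_1}^+\cdots\sigma_{D_N}^+|\mathbf 0\rangle,\qquad \mathcal G_\Lambda=\operatorname{span}\{\psi_\Lambda(R) : R\in\mathcal R_\Lambda\},$$ where $|\mathbf 0\rangle$ is the vector with all sites vacant, and $\sigma_D^+=1$ if $D$ is a void, $\sigma_D^+=\sigma_x^+$ if $D$ is a monomer (basic or right) whose particle is at $x$, and $\sigma_D^+=\lambda\,\sigma_{y}^+\sigma_{y+1}^+$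 if $D$ is a dimer (basic, left, right or truncated) whose particles are at $y$ and $y+1$. Then: 1. If $|\Lambda|\in\{5,6\}$ or $|\Lambda|\ge 8$, then $\ker H_\Lambda=\mathcal G_\Lambda$. 2. If $|\Lambda|=7$, then $\ker H_\Lambda=\mathcal G_\Lambda\oplus\operatorname{span}\{|1100011\rangle\}$, an orthogonal direct sum. 3. The VMD states $\psi_\Lambda(R)$, $R\in\mathcal R_\Lambda$, are pairwise orthogonal and, indexed by $\mathcal R_\Lambda$, form a basis of $\mathcal G_\Lambda$. -/

import Mathlib

/-! ### The spin chain on a finite interval `Λ = [a, b] ⊂ ℤ` -/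

/-- Particle configurations `σ ∈ {0,1}^Λ` on `Λ = [a, b]`; the value `1` at a site means
that the site is occupied (spin up), `0` that it is vacant (spin down). -/
abbrev Config (a b : ℤ) : Type := Set.Icc a b → Fin 2

/-- The Hilbert space `⨂_{x ∈ Λ} ℂ²` in its canonical orthonormal product basis `|σ⟩`,
`σ ∈ {0,1}^Λ`: a vector is given by its coordinates `ψ(σ)`. -/
abbrev Hilb (a b : ℤ) : Type := EuclideanSpace ℂ (Config a b)

/-- The canonical basis vector `|σ⟩`. -/
noncomputable def ket {a b : ℤ} (σ : Config a b) : Hilb a b := EuclideanSpace.single σ 1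

/-- The operator on `⨂_{y ∈ Λ} ℂ²` that acts as the `2 × 2` matrix `A` on the tensor factor
of the site `x` and as the identity on all other factors.  The matrix is written in the basis
`|0⟩, |1⟩`, in this order. -/
noncomputable def onSite {a b : ℤ} (x : Set.Icc a b) (A : Matrix (Fin 2) (Fin 2) ℂ) :
    Hilb a b →ₗ[ℂ] Hilb a b where
  toFun ψ := WithLp.toLp 2 fun σ => ∑ t : Fin 2, A (σ x) t * ψ (Function.update σ x t)
  map_add' φ ψ := by
    ext σ
    simp only [PiLp.add_apply, mul_add, Finset.sum_add_distrib]
  map_smul' c ψ := by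
    ext σ
    simp only [PiLp.smul_apply, smul_eq_mul, RingHom.id_apply, Finset.mul_sum]
    exact Finset.sum_congr rfl fun t _ => by ring

/-- The operator `onSite` for a site given as an integer `x`.  (The value `0` for `x ∉ Λ` is
never used: all sites that occur below lie in `Λ`.) -/
noncomputable def siteOp (a b x : ℤ) (A : Matrix (Fin 2) (Fin 2) ℂ) :
    Hilb a b →ₗ[ℂ] Hilb a b :=
  if h : x ∈ Set.Icc a b then onSite ⟨x, h⟩ A else 0

/-- The raising operator `σ_x^+`, with `σ^+ |0⟩ = |1⟩` and `σ^+ |1⟩ = 0`. -/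
noncomputable def raiseOp (a b x : ℤ) : Hilb a b →ₗ[ℂ] Hilb a b :=
  siteOp a b x !![0, 0; 1, 0]

/-- The lowering operator `σ_x^-`, with `σ^- |1⟩ = |0⟩` and `σ^- |0⟩ = 0`. -/
noncomputable def lowerOp (a b x : ℤ) : Hilb a b →ₗ[ℂ] Hilb a b :=
  siteOp a b x !![0, 1; 0, 0]

/-- The third Pauli matrix `σ_x^3`, with `σ^3 |1⟩ = |1⟩` and `σ^3 |0⟩ = -|0⟩`. -/
noncomputable def pauliZ (a b x : ℤ) : Hilb a b →ₗ[ℂ] Hilb a b :=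
  siteOp a b x !![-1, 0; 0, 1]

/-- The occupation number `n_x = (σ_x^3 + 1) / 2`. -/
noncomputable def numOp (a b x : ℤ) : Hilb a b →ₗ[ℂ] Hilb a b :=
  (1 / 2 : ℂ) • (pauliZ a b x + 1)

/-- `q_x = σ_{x+1}^- σ_{x+2}^- - lam σ_x^- σ_{x+3}^-`. -/
noncomputable def qOp (lam : ℂ) (a b x : ℤ) : Hilb a b →ₗ[ℂ] Hilb a b :=
  lowerOp a b (x + 1) * lowerOp a b (x + 2) - lam • (lowerOp a b x * lowerOp a b (x + 3))

/-- The Hamiltonian with open boundary conditions on `Λ = [a, b]`: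
`H_Λ = ∑_{x=a}^{b-2} n_x n_{x+2} + κ ∑_{x=a}^{b-3} q_x^* q_x`. -/
noncomputable def hamiltonian (lam : ℂ) (κ : ℝ) (a b : ℤ) : Hilb a b →ₗ[ℂ] Hilb a b :=
  ∑ x ∈ Finset.Icc a (b - 2), numOp a b x * numOp a b (x + 2) +
    (κ : ℂ) • ∑ x ∈ Finset.Icc a (b - 3), LinearMap.adjoint (qOp lam a b x) * qOp lam a b x

/-! ### Tilings -/

/-- The dominoes: voids, basic monomers, basic dimers and the six boundary tiles. -/
inductive Tile where
  | void
  | monomer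
  | dimer
  | leftDimer
  | rightDimer
  | rightMonomer1
  | rightMonomer2
  | truncDimer1
  | truncDimer2
  deriving DecidableEq

instance : Fintype Tile where
  elems := {.void, .monomer, .dimer, .leftDimer, .rightDimer, .rightMonomer1, .rightMonomer2,
    .truncDimer1, .truncDimer2}
  complete D := by cases D <;> decide

/-- The number of sites covered by a tile. -/
def Tile.size : Tile → ℕ
  | .void => 1
  | .monomer => 3
  | .dimer => 6
  | .leftDimer => 5
  | .rightDimer => 3
  | .rightMonomer1 => 1
  | .rightMonomer2 => 2
  | .truncDimer1 => 4
  | .truncDimer2 => 5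

/-- `R` is a root tiling of `[a, b]`, written as the list of its tiles from left to right: a left
boundary tile (none or the left dimer), then any voids and basic monomers, then a right boundary
tile (none, the right dimer, the right `1`-monomer or the right `2`-monomer), which together cover
exactly `[a, b]`. -/
def IsRootTiling (a b : ℤ) (R : List Tile) : Prop :=
  (∃ l m r : List Tile,
    R = l ++ m ++ r ∧
    (l = [] ∨ l = [.leftDimer]) ∧
    (∀ D ∈ m, D = .void ∨ D = .monomer) ∧
    (r = [] ∨ r = [.rightDimer] ∨ r = [.rightMonomer1] ∨ r = [.rightMonomer2])) ∧
  ((R.map Tile.size).sum : ℤ) = b - a + 1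

/-- The set of all root tilings of `[a, b]`. -/
abbrev RootTiling (a b : ℤ) : Type := {R : List Tile // IsRootTiling a b R}

/-- The substitution rules: two adjacent basic monomers may be replaced by a basic dimer, and a
basic monomer followed by a right `j`-monomer by the truncated `j`-dimer, `j = 1, 2`. -/
inductive Subst : List Tile → List Tile → Prop
  | basic (p s : List Tile) :
      Subst (p ++ [.monomer, .monomer] ++ s) (p ++ [.dimer] ++ s)
  | trunc1 (p : List Tile) :
      Subst (p ++ [.monomer, .rightMonomer1]) (p ++ [.truncDimer1])
  | trunc2 (p : List Tile) :
      Subst (p ++ [.monomer, .rightMonomer2]) (p ++ [.truncDimer2])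

/-- The tilings obtained from the tiling `R` by finitely many (possibly no) substitutions. -/
def substTilings (R : List Tile) : Set (List Tile) :=
  {D | Relation.ReflTransGen Subst R D}

theorem substTilings_finite (R : List Tile) : (substTilings R).Finite := by
  refine (List.finite_length_le Tile R.length).subset ?_
  intro D hD
  induction hD with
  | refl => exact le_refl R.length
  | tail _ h ih =>
    simp only [Set.mem_ofPred_eq] at ih ⊢
    cases h <;> simp only [List.length_append, List.length_cons, List.length_nil] at ih ⊢ <;> omega

/-- The finite collection `D_Λ(R)` of all void-monomer-dimer tilings derived from `R`. -/
noncomputable def vmdTilings (R : List Tile) : Finset (List Tile) :=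
  (substTilings_finite R).toFinset

/-! ### VMD states -/

/-- The operator of a tile whose first covered site is `x`: the identity for a void, the raising
operator at the first site for a monomer, and `lam` times the product of the two raising operators
at the occupied sites for a dimer.  These are the second and third site of the tile, except for
the left dimer, which has lost its first site. -/
noncomputable def tileOp (lam : ℂ) (a b x : ℤ) : Tile → (Hilb a b →ₗ[ℂ] Hilb a b)
  | .void => 1
  | .monomer | .rightMonomer1 | .rightMonomer2 => raiseOp a b x
  | .dimer | .rightDimer | .truncDimer1 | .truncDimer2 =>
      lam • (raiseOp a b (x + 1) * raiseOp a b (x + 2))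
  | .leftDimer => lam • (raiseOp a b x * raiseOp a b (x + 1))

/-- The product `σ_{D_1}^+ ⋯ σ_{D_N}^+` for tiles `D_1, …, D_N` laid side by side, the first
one starting at the site `x`. -/
noncomputable def tilingOp (lam : ℂ) (a b : ℤ) : ℤ → List Tile → (Hilb a b →ₗ[ℂ] Hilb a b)
  | _, [] => 1
  | x, D :: Ds => tileOp lam a b x D * tilingOp lam a b (x + D.size) Ds

/-- The VMD state `ψ_Λ(R) = ∑_{D ∈ D_Λ(R)} σ_{D_1}^+ ⋯ σ_{D_N}^+ |0⟩`. -/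
noncomputable def vmdState (lam : ℂ) {a b : ℤ} (R : RootTiling a b) : Hilb a b :=
  ∑ D ∈ vmdTilings R.1, tilingOp lam a b a D (ket fun _ => 0)

/-- The VMD space, the span of all VMD states on `[a, b]`. -/
noncomputable def vmdSpace (lam : ℂ) (a b : ℤ) : Submodule ℂ (Hilb a b) :=
  Submodule.span ℂ (Set.range fun R : RootTiling a b => vmdState lam R)

/-- The basis vector `|1100011⟩` of an interval `[a, b]` with seven sites, occupied exactly at the
first two and the last two sites. -/
noncomputable def extraKet (a b : ℤ) : Hilb a b :=
  ket fun x => if x.1 = a ∨ x.1 = a + 1 ∨ x.1 = a + 5 ∨ x.1 = a + 6 then 1 else 0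

/-!
A configuration is written as the word of its occupation numbers. The Hamiltonian is a sum of
nonnegative terms, so a vector has zero energy if and only if each term annihilates it, and in the
occupation basis this says two things about its amplitudes (`IsZeroEnergy`): they vanish on words
with a factor `1u1`, and the amplitude of `p0110s` is `lam` times that of `p1001s`
(`mem_ker_hamiltonian_iff_isZeroEnergy`). Hence an amplitude is determined along the hopping moves
`1001 ↔ 0110`, and it vanishes on every word that can be moved to a word with a factor `1u1`.

A word is the content of at most one void-monomer-dimer tiling (`IsVMD.word_inj`). Contents of
tilings have no factor `1u1`, and each hopping move in them is the substitution of a dimer for a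
pair of monomers or its inverse, so that it preserves the root (`IsVMD.exists_unsubst`,
`IsVMD.exists_subst`). As the tilings derived from a root tiling `R` are exactly those with root
`R` (`mem_vmdTilings`), the VMD states have zero energy, and their supports are disjoint, which
gives orthogonality and the basis.

Conversely, when a word is tiled greedily from the left and no tile fits, then a few moves lead
to a factor `1u1`, except for the word `1100011`
(`IsZeroEnergy.exists_vmd_or_eq_zero`). So a zero-energy state is determined by its amplitudes at
the root tilings, up to a multiple of `1100011` on seven sites.
-/

/-! ### Words and validity of tilings -/

/-- The particle content of a tile. -/
def Tile.bits : Tile → List (Fin 2)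
  | .void => [0]
  | .monomer => [1, 0, 0]
  | .dimer => [0, 1, 1, 0, 0, 0]
  | .leftDimer => [1, 1, 0, 0, 0]
  | .rightDimer => [0, 1, 1]
  | .rightMonomer1 => [1]
  | .rightMonomer2 => [1, 0]
  | .truncDimer1 => [0, 1, 1, 0]
  | .truncDimer2 => [0, 1, 1, 0, 0]

/-- The word `σ` of occupation numbers described by a list of tiles laid side by side. -/
def tilingWord (D : List Tile) : List (Fin 2) := D.flatMap Tile.bits

/-- The tiles of the root tiling underneath a tile: substituted tiles are split up again. -/
def Tile.expand : Tile → List Tile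
  | .dimer => [.monomer, .monomer]
  | .truncDimer1 => [.monomer, .rightMonomer1]
  | .truncDimer2 => [.monomer, .rightMonomer2]
  | T => [T]

/-- The tiling in which all substitutions have been undone. -/
def rootOf (D : List Tile) : List Tile := D.flatMap Tile.expand

/-- The exponent of `lam` in the operator of a tile. -/
def Tile.weight : Tile → ℕ
  | .dimer | .leftDimer | .rightDimer | .truncDimer1 | .truncDimer2 => 1
  | _ => 0

/-- The number of dimers of all kinds in a tiling. -/
def dimerCount (D : List Tile) : ℕ := (D.map Tile.weight).sum

/-- The number of sites covered by a tiling. -/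
def tilingSize (D : List Tile) : ℕ := (D.map Tile.size).sum

section
variable (T : Tile) (D E : List Tile)

@[simp] theorem tilingWord_nil : tilingWord [] = [] := rfl
@[simp] theorem tilingWord_cons : tilingWord (T :: D) = T.bits ++ tilingWord D := rfl
@[simp] theorem rootOf_nil : rootOf [] = [] := rfl
@[simp] theorem rootOf_cons : rootOf (T :: D) = T.expand ++ rootOf D := rfl
@[simp] theorem rootOf_append : rootOf (D ++ E) = rootOf D ++ rootOf E := by simp [rootOf]
@[simp] theorem dimerCount_nil : dimerCount [] = 0 := rfl
@[simp] theorem dimerCount_cons : dimerCount (T :: D) = T.weight + dimerCount D := by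
  simp [dimerCount]
@[simp] theorem tilingSize_nil : tilingSize [] = 0 := rfl
@[simp] theorem tilingSize_cons : tilingSize (T :: D) = T.size + tilingSize D := by
  simp [tilingSize]
@[simp] theorem tilingSize_append : tilingSize (D ++ E) = tilingSize D + tilingSize E := by
  simp [tilingSize]

theorem length_bits : T.bits.length = T.size := by cases T <;> rfl

theorem tilingSize_expand : tilingSize T.expand = T.size := by cases T <;> rfl

theorem length_tilingWord : (tilingWord D).length = tilingSize D := by
  induction D with
  | nil => rfl
  | cons T D ih => simp [length_bits, ih]

theorem tilingSize_rootOf : tilingSize (rootOf D) = tilingSize D := by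
  induction D with
  | nil => rfl
  | cons T D ih => simp [tilingSize_expand, ih]

end

/-- The void-monomer-dimer tilings without a left dimer. -/
inductive IsTail : List Tile → Prop
  | nil : IsTail []
  | void {D : List Tile} : IsTail D → IsTail (.void :: D)
  | monomer {D : List Tile} : IsTail D → IsTail (.monomer :: D)
  | dimer {D : List Tile} : IsTail D → IsTail (.dimer :: D)
  | rightDimer : IsTail [.rightDimer]
  | rightMonomer1 : IsTail [.rightMonomer1]
  | rightMonomer2 : IsTail [.rightMonomer2]
  | truncDimer1 : IsTail [.truncDimer1]
  | truncDimer2 : IsTail [.truncDimer2]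

/-- The void-monomer-dimer tilings: a left dimer may stand in front of a tail. -/
inductive IsVMD : List Tile → Prop
  | tail {D : List Tile} : IsTail D → IsVMD D
  | left {D : List Tile} : IsTail D → IsVMD (.leftDimer :: D)

theorem rootOf_eq_nil {D : List Tile} (h : rootOf D = []) : D = [] := by
  cases D with
  | nil => rfl
  | cons T D => cases T <;> simp [Tile.expand] at h

theorem IsTail.of_rootOf {D : List Tile} (h : IsTail (rootOf D)) : IsTail D := by
  induction D with
  | nil => exact .nil
  | cons T D ih =>
    cases T <;> simp only [rootOf_cons, Tile.expand, List.cons_append, List.nil_append] at h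
    case void => cases h with | void h => exact .void (ih h)
    case monomer => cases h with | monomer h => exact .monomer (ih h)
    case dimer => cases h with | monomer h => cases h with | monomer h => exact .dimer (ih h)
    case leftDimer => cases h
    case truncDimer1 =>
      cases h with
      | monomer h =>
        generalize hr : rootOf D = r at h
        cases h
        cases rootOf_eq_nil hr
        exact .truncDimer1
    case truncDimer2 =>
      cases h with
      | monomer h =>
        generalize hr : rootOf D = r at h
        cases h
        cases rootOf_eq_nil hr
        exact .truncDimer2
    all_goals
      generalize hr : rootOf D = r at h
      cases h
      cases rootOf_eq_nil hr
      constructor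

theorem IsVMD.of_rootOf {D : List Tile} (h : IsVMD (rootOf D)) : IsVMD D := by
  generalize hr : rootOf D = r at h
  cases h with
  | tail h => exact .tail (IsTail.of_rootOf (hr ▸ h))
  | left h =>
    cases D with
    | nil => simp at hr
    | cons T D =>
      cases T <;> simp [Tile.expand] at hr
      exact .left (IsTail.of_rootOf (hr ▸ h))

/-! ### Substitutions -/

theorem Subst.rootOf_eq {D E : List Tile} (h : Subst D E) : rootOf E = rootOf D := by
  cases h <;> simp [Tile.expand]

theorem Subst.cons {D E : List Tile} (T : Tile) (h : Subst D E) : Subst (T :: D) (T :: E) := by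
  cases h with
  | basic p s => exact .basic (T :: p) s
  | trunc1 p => exact .trunc1 (T :: p)
  | trunc2 p => exact .trunc2 (T :: p)

theorem substTilings_cons {D E : List Tile} (T : Tile) (h : Relation.ReflTransGen Subst D E) :
    Relation.ReflTransGen Subst (T :: D) (T :: E) :=
  h.lift (T :: ·) fun _ _ => Subst.cons T

theorem IsTail.substTilings {D : List Tile} (h : IsTail D) :
    Relation.ReflTransGen Subst (rootOf D) D := by
  induction h with
  | void _ ih => exact substTilings_cons _ ih
  | monomer _ ih => exact substTilings_cons _ ih
  | dimer _ ih =>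
    exact (substTilings_cons _ (substTilings_cons _ ih)).tail (.basic [] _)
  | truncDimer1 => exact .single (.trunc1 [])
  | truncDimer2 => exact .single (.trunc2 [])
  | _ => exact .refl

theorem IsVMD.substTilings {D : List Tile} (h : IsVMD D) :
    Relation.ReflTransGen Subst (rootOf D) D := by
  cases h with
  | tail h => exact h.substTilings
  | left h => exact substTilings_cons _ h.substTilings

theorem isTail_of_root {m r : List Tile} (hm : ∀ T ∈ m, T = .void ∨ T = .monomer)
    (hr : r = [] ∨ r = [.rightDimer] ∨ r = [.rightMonomer1] ∨ r = [.rightMonomer2]) :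
    IsTail (m ++ r) ∧ rootOf (m ++ r) = m ++ r := by
  induction m with
  | nil =>
    rcases hr with rfl | rfl | rfl | rfl <;> exact ⟨by constructor, rfl⟩
  | cons T m ih =>
    obtain ⟨h1, h2⟩ := ih fun T hT => hm T (List.mem_cons_of_mem _ hT)
    rcases hm T List.mem_cons_self with rfl | rfl
    · exact ⟨.void h1, congrArg (Tile.void :: ·) h2⟩
    · exact ⟨.monomer h1, congrArg (Tile.monomer :: ·) h2⟩

theorem IsRootTiling.isVMD {a b : ℤ} {R : List Tile} (h : IsRootTiling a b R) :
    IsVMD R ∧ rootOf R = R ∧ (tilingSize R : ℤ) = b - a + 1 := by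
  obtain ⟨⟨l, m, r, rfl, hl, hm, hr⟩, hs⟩ := h
  obtain ⟨h1, h2⟩ := isTail_of_root hm hr
  refine ⟨?_, ?_, hs⟩
  · rcases hl with rfl | rfl
    · exact .tail h1
    · exact .left h1
  · rcases hl with rfl | rfl
    · exact h2
    · exact congrArg (Tile.leftDimer :: ·) h2

theorem IsTail.rootOf_eq_append {D : List Tile} (h : IsTail D) :
    ∃ m r : List Tile, rootOf D = m ++ r ∧ (∀ T ∈ m, T = .void ∨ T = .monomer) ∧
      (r = [] ∨ r = [.rightDimer] ∨ r = [.rightMonomer1] ∨ r = [.rightMonomer2]) := by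
  induction h with
  | nil => exact ⟨[], [], rfl, by simp, by simp⟩
  | void _ ih =>
    obtain ⟨m, r, h1, h2, h3⟩ := ih
    exact ⟨.void :: m, r, by simp [h1, Tile.expand], by simpa using h2, h3⟩
  | monomer _ ih =>
    obtain ⟨m, r, h1, h2, h3⟩ := ih
    exact ⟨.monomer :: m, r, by simp [h1, Tile.expand], by simpa using h2, h3⟩
  | dimer _ ih =>
    obtain ⟨m, r, h1, h2, h3⟩ := ih
    exact ⟨.monomer :: .monomer :: m, r, by simp [h1, Tile.expand], by simpa using h2, h3⟩
  | rightDimer => exact ⟨[], [.rightDimer], rfl, by simp, by simp⟩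
  | rightMonomer1 => exact ⟨[], [.rightMonomer1], rfl, by simp, by simp⟩
  | rightMonomer2 => exact ⟨[], [.rightMonomer2], rfl, by simp, by simp⟩
  | truncDimer1 => exact ⟨[.monomer], [.rightMonomer1], rfl, by simp, by simp⟩
  | truncDimer2 => exact ⟨[.monomer], [.rightMonomer2], rfl, by simp, by simp⟩

theorem IsVMD.isRootTiling_rootOf {a b : ℤ} {D : List Tile} (h : IsVMD D)
    (hs : (tilingSize D : ℤ) = b - a + 1) : IsRootTiling a b (rootOf D) := by
  rw [← tilingSize_rootOf] at hs
  refine ⟨?_, hs⟩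
  cases h with
  | tail h =>
    obtain ⟨m, r, h1, h2, h3⟩ := h.rootOf_eq_append
    exact ⟨[], m, r, by simpa using h1, by simp, h2, h3⟩
  | left h =>
    obtain ⟨m, r, h1, h2, h3⟩ := h.rootOf_eq_append
    exact ⟨[.leftDimer], m, r, by simp [h1, Tile.expand], by simp, h2, h3⟩

/-- The tilings derived from a root tiling `R` are exactly those with root `R`. -/
theorem mem_vmdTilings {a b : ℤ} {R D : List Tile} (hR : IsRootTiling a b R) :
    D ∈ vmdTilings R ↔ rootOf D = R := by
  obtain ⟨hv, hr, -⟩ := hR.isVMD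
  rw [vmdTilings, Set.Finite.mem_toFinset]
  constructor
  · intro h
    have h' : Relation.ReflTransGen Subst R D := h
    rw [← hr]
    induction h' with
    | refl => rfl
    | tail h1 h2 ih => rw [h2.rootOf_eq, ih h1]
  · rintro rfl
    exact (IsVMD.of_rootOf hv).substTilings

/-! ### Words of tilings -/

theorem IsTail.word_ne {D : List Tile} (h : IsTail D) (s : List (Fin 2)) :
    tilingWord D ≠ 1 :: 1 :: s := by
  cases h <;> simp [Tile.bits]

theorem IsTail.word_inj {D E : List Tile} (hD : IsTail D) (hE : IsTail E)
    (h : tilingWord D = tilingWord E) : D = E := by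
  induction hD generalizing E with
  | void hD ih =>
    cases hE <;> simp [Tile.bits] at h
    case void hE => rw [ih hE h]
    all_goals exact absurd h (hD.word_ne _)
  | monomer hD ih =>
    cases hE <;> simp [Tile.bits] at h
    case monomer hE => rw [ih hE h]
  | dimer hD ih =>
    cases hE <;> simp [Tile.bits] at h
    case void hE => exact absurd h.symm (hE.word_ne _)
    case dimer hE => rw [ih hE h]
  | _ =>
    cases hE <;> simp [Tile.bits] at h <;> first | rfl | exact absurd h.symm (IsTail.word_ne ‹_› _)

/-- A configuration has at most one tiling. -/
theorem IsVMD.word_inj {D E : List Tile} (hD : IsVMD D) (hE : IsVMD E)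
    (h : tilingWord D = tilingWord E) : D = E := by
  cases hD with
  | tail hD =>
    cases hE with
    | tail hE => exact hD.word_inj hE h
    | left hE => exact absurd h (hD.word_ne _)
  | left hD =>
    cases hE with
    | tail hE => exact absurd h.symm (hE.word_ne _)
    | left hE =>
      simp [Tile.bits] at h
      rw [hD.word_inj hE h]

theorem IsTail.word_ne_blocked {D : List Tile} (h : IsTail D) (p s : List (Fin 2)) (u : Fin 2) :
    tilingWord D ≠ p ++ 1 :: u :: 1 :: s := by
  induction h generalizing p with
  | void _ ih =>
    rcases p with _ | ⟨c0, p⟩ <;> simp [Tile.bits]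
    rintro -
    exact ih p
  | monomer _ ih =>
    rcases p with _ | ⟨c0, _ | ⟨c1, _ | ⟨c2, p⟩⟩⟩ <;> simp [Tile.bits]
    rintro - - -
    exact ih p
  | dimer _ ih =>
    rcases p with _ | ⟨c0, _ | ⟨c1, _ | ⟨c2, _ | ⟨c3, _ | ⟨c4, _ | ⟨c5, p⟩⟩⟩⟩⟩⟩ <;>
      simp [Tile.bits]
    rintro - - - - - -
    exact ih p
  | _ =>
    intro hw
    have hl := congrArg List.length hw
    rcases p with _ | ⟨c0, _ | ⟨c1, _ | ⟨c2, p⟩⟩⟩ <;> simp [Tile.bits] at hw hl <;> omega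

theorem IsVMD.word_ne_blocked {D : List Tile} (h : IsVMD D) (p s : List (Fin 2)) (u : Fin 2) :
    tilingWord D ≠ p ++ 1 :: u :: 1 :: s := by
  cases h with
  | tail h => exact h.word_ne_blocked p s u
  | left h =>
    rcases p with _ | ⟨c0, _ | ⟨c1, _ | ⟨c2, _ | ⟨c3, _ | ⟨c4, p⟩⟩⟩⟩⟩ <;> simp [Tile.bits]
    rintro - - - - -
    exact h.word_ne_blocked p s u

/-- Where the word of a tiling reads `0110`, these sites belong to a substituted dimer, and
undoing this substitution turns `0110` into `1001`. -/
theorem IsTail.exists_unsubst {D : List Tile} (h : IsTail D) (p s : List (Fin 2))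
    (hw : tilingWord D = p ++ 0 :: 1 :: 1 :: 0 :: s) :
    ∃ E, IsTail E ∧ rootOf E = rootOf D ∧ dimerCount D = dimerCount E + 1 ∧
      tilingWord E = p ++ 1 :: 0 :: 0 :: 1 :: s := by
  induction h generalizing p with
  | void h ih =>
    rcases p with _ | ⟨c, p⟩
    · simp [Tile.bits] at hw
      exact absurd hw (h.word_ne _)
    · simp [Tile.bits] at hw
      obtain ⟨E, h1, h2, h3, h4⟩ := ih p hw.2
      exact ⟨.void :: E, .void h1, by simp [h2], by simp [h3, Tile.weight],
        by simp [Tile.bits, h4, hw.1]⟩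
  | monomer h ih =>
    rcases p with _ | ⟨c0, _ | ⟨c1, _ | ⟨c2, p⟩⟩⟩ <;> simp [Tile.bits] at hw
    · exact absurd hw.2.2 (h.word_ne _)
    · obtain ⟨rfl, rfl, rfl, hw⟩ := hw
      obtain ⟨E, h1, h2, h3, h4⟩ := ih p hw
      exact ⟨.monomer :: E, .monomer h1, by simp [h2], by simp [h3, Tile.weight],
        by simp [Tile.bits, h4]⟩
  | dimer h ih =>
    rcases p with _ | ⟨c0, _ | ⟨c1, _ | ⟨c2, _ | ⟨c3, _ | ⟨c4, _ | ⟨c5, p⟩⟩⟩⟩⟩⟩ <;>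
      simp [Tile.bits] at hw
    · exact ⟨.monomer :: .monomer :: _, .monomer (.monomer h), by simp [Tile.expand],
        by simp [Tile.weight]; omega, by simp [Tile.bits, ← hw]⟩
    · exact absurd hw.2.2.2.2.2 (h.word_ne _)
    · obtain ⟨rfl, rfl, rfl, rfl, rfl, rfl, hw⟩ := hw
      obtain ⟨E, h1, h2, h3, h4⟩ := ih p hw
      exact ⟨.dimer :: E, .dimer h1, by simp [h2], by simp [h3, Tile.weight]; omega,
        by simp [Tile.bits, h4]⟩
  | truncDimer1 =>
    have hl := congrArg List.length hw
    rcases p with _ | ⟨c0, _ | ⟨c1, p⟩⟩ <;> simp [Tile.bits] at hw hl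
    · exact ⟨[.monomer, .rightMonomer1], .monomer .rightMonomer1, rfl, rfl,
        by simp [Tile.bits, hw]⟩
    · omega
  | truncDimer2 =>
    have hl := congrArg List.length hw
    rcases p with _ | ⟨c0, _ | ⟨c1, p⟩⟩ <;> simp [Tile.bits] at hw hl
    · exact ⟨[.monomer, .rightMonomer2], .monomer .rightMonomer2, rfl, rfl,
        by simp [Tile.bits, ← hw]⟩
    · omega
  | _ =>
    have hl := congrArg List.length hw
    simp [Tile.bits] at hl <;> omega

theorem IsVMD.exists_unsubst {D : List Tile} (h : IsVMD D) (p s : List (Fin 2))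
    (hw : tilingWord D = p ++ 0 :: 1 :: 1 :: 0 :: s) :
    ∃ E, IsVMD E ∧ rootOf E = rootOf D ∧ dimerCount D = dimerCount E + 1 ∧
      tilingWord E = p ++ 1 :: 0 :: 0 :: 1 :: s := by
  cases h with
  | tail h =>
    obtain ⟨E, h1, h2⟩ := h.exists_unsubst p s hw
    exact ⟨E, .tail h1, h2⟩
  | left h =>
    rcases p with _ | ⟨c0, _ | ⟨c1, _ | ⟨c2, _ | ⟨c3, _ | ⟨c4, p⟩⟩⟩⟩⟩ <;> simp [Tile.bits] at hw
    · exact absurd hw.2.2.2.2 (h.word_ne _)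
    · obtain ⟨rfl, rfl, rfl, rfl, rfl, hw⟩ := hw
      obtain ⟨E, h1, h2, h3, h4⟩ := h.exists_unsubst p s hw
      exact ⟨.leftDimer :: E, .left h1, by simp [h2], by simp [h3, Tile.weight]; omega,
        by simp [Tile.bits, h4]⟩

/-- Where the word of a tiling reads `1001`, a monomer is followed by a monomer or a right
monomer, and substituting these turns `1001` into `0110`. -/
theorem IsTail.exists_subst {D : List Tile} (h : IsTail D) (p s : List (Fin 2))
    (hw : tilingWord D = p ++ 1 :: 0 :: 0 :: 1 :: s) :
    ∃ E, IsTail E ∧ tilingWord E = p ++ 0 :: 1 :: 1 :: 0 :: s := by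
  induction h generalizing p with
  | void h ih =>
    rcases p with _ | ⟨c, p⟩ <;> simp [Tile.bits] at hw
    obtain ⟨E, h1, h2⟩ := ih p hw.2
    exact ⟨.void :: E, .void h1, by simp [Tile.bits, h2, hw.1]⟩
  | monomer h ih =>
    rcases p with _ | ⟨c0, _ | ⟨c1, _ | ⟨c2, p⟩⟩⟩ <;> simp [Tile.bits] at hw
    · cases h <;> simp [Tile.bits] at hw
      case monomer h => exact ⟨.dimer :: _, .dimer h, by simp [Tile.bits, ← hw]⟩
      case rightMonomer1 => exact ⟨[.truncDimer1], .truncDimer1, by simp [Tile.bits, hw]⟩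
      case rightMonomer2 => exact ⟨[.truncDimer2], .truncDimer2, by simp [Tile.bits, ← hw]⟩
    · obtain ⟨rfl, rfl, rfl, hw⟩ := hw
      obtain ⟨E, h1, h2⟩ := ih p hw
      exact ⟨.monomer :: E, .monomer h1,
        by simp [Tile.bits, h2]⟩
  | dimer h ih =>
    rcases p with _ | ⟨c0, _ | ⟨c1, _ | ⟨c2, _ | ⟨c3, _ | ⟨c4, _ | ⟨c5, p⟩⟩⟩⟩⟩⟩ <;>
      simp [Tile.bits] at hw
    obtain ⟨rfl, rfl, rfl, rfl, rfl, rfl, hw⟩ := hw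
    obtain ⟨E, h1, h2⟩ := ih p hw
    exact ⟨.dimer :: E, .dimer h1,
      by simp [Tile.bits, h2]⟩
  | _ =>
    have hl := congrArg List.length hw
    rcases p with _ | ⟨c0, _ | ⟨c1, p⟩⟩ <;> simp [Tile.bits] at hw hl <;> omega

theorem IsVMD.exists_subst {D : List Tile} (h : IsVMD D) (p s : List (Fin 2))
    (hw : tilingWord D = p ++ 1 :: 0 :: 0 :: 1 :: s) :
    ∃ E, IsVMD E ∧ tilingWord E = p ++ 0 :: 1 :: 1 :: 0 :: s := by
  cases h with
  | tail h =>
    obtain ⟨E, h1, h2⟩ := h.exists_subst p s hw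
    exact ⟨E, .tail h1, h2⟩
  | left h =>
    rcases p with _ | ⟨c0, _ | ⟨c1, _ | ⟨c2, _ | ⟨c3, _ | ⟨c4, p⟩⟩⟩⟩⟩ <;> simp [Tile.bits] at hw
    obtain ⟨rfl, rfl, rfl, rfl, rfl, hw⟩ := hw
    obtain ⟨E, h1, h2⟩ := h.exists_subst p s hw
    exact ⟨.leftDimer :: E, .left h1,
      by simp [Tile.bits, h2]⟩

/-! ### Amplitudes of zero-energy states -/

/-- The local constraints that characterize the amplitudes `f` of a zero-energy state on a chain
with `n` sites: no two particles at distance two, and the pattern `0110` carries `lam` times the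
amplitude of `1001` in the same environment. -/
structure IsZeroEnergy (lam : ℂ) (n : ℕ) (f : List (Fin 2) → ℂ) : Prop where
  blocked : ∀ (p s : List (Fin 2)) (u : Fin 2), p.length + 3 + s.length = n →
    f (p ++ 1 :: u :: 1 :: s) = 0
  hop : ∀ p s : List (Fin 2), p.length + 4 + s.length = n →
    f (p ++ 0 :: 1 :: 1 :: 0 :: s) = lam * f (p ++ 1 :: 0 :: 0 :: 1 :: s)

namespace IsZeroEnergy

variable {lam : ℂ} {n : ℕ} {f : List (Fin 2) → ℂ}

/-- The pattern `10011` hops to the blocked pattern `01101`. -/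
theorem one_zero_zero_one_one (hf : IsZeroEnergy lam n f) (hlam : lam ≠ 0) (p s : List (Fin 2))
    (hn : p.length + 5 + s.length = n) : f (p ++ 1 :: 0 :: 0 :: 1 :: 1 :: s) = 0 := by
  have h1 := hf.hop p (1 :: s) (by simp; omega)
  have h2 := hf.blocked (p ++ [0, 1]) s 0 (by simp; omega)
  simp only [List.append_assoc, List.cons_append, List.nil_append] at h2
  rw [h2] at h1
  simpa [hlam] using h1.symm

/-- The pattern `11001` hops to the blocked pattern `10110`. -/
theorem one_one_zero_zero_one (hf : IsZeroEnergy lam n f) (hlam : lam ≠ 0) (p s : List (Fin 2))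
    (hn : p.length + 5 + s.length = n) : f (p ++ 1 :: 1 :: 0 :: 0 :: 1 :: s) = 0 := by
  have h1 := hf.hop (p ++ [1]) s (by simp; omega)
  have h2 := hf.blocked p (1 :: 0 :: s) 0 (by simp; omega)
  simp only [List.append_assoc, List.cons_append, List.nil_append] at h1
  rw [h2] at h1
  simpa [hlam] using h1.symm

/-- The pattern `011001` hops to the blocked pattern `100101`. -/
theorem zero_one_one_zero_zero_one (hf : IsZeroEnergy lam n f) (p s : List (Fin 2))
    (hn : p.length + 6 + s.length = n) : f (p ++ 0 :: 1 :: 1 :: 0 :: 0 :: 1 :: s) = 0 := by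
  have h1 := hf.hop p (0 :: 1 :: s) (by simp; omega)
  have h2 := hf.blocked (p ++ [1, 0, 0]) s 0 (by simp; omega)
  simp only [List.append_assoc, List.cons_append, List.nil_append] at h2
  rw [h1, h2, mul_zero]

/-- Every amplitude on a configuration without tiling vanishes, provided that the part to the
right of what has been tiled does not start with `11`. -/
theorem exists_tail_or_eq_zero (hf : IsZeroEnergy lam n f) (hlam : lam ≠ 0) :
    ∀ (w p : List (Fin 2)), p.length + w.length = n → (∀ s, w ≠ 1 :: 1 :: s) →
      (∃ D, IsTail D ∧ tilingWord D = w) ∨ f (p ++ w) = 0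
  | [], _, _, _ => .inl ⟨[], .nil, rfl⟩
  | [1], _, _, _ => .inl ⟨_, .rightMonomer1, rfl⟩
  | [1, 0], _, _, _ => .inl ⟨_, .rightMonomer2, rfl⟩
  | 1 :: 1 :: s, _, _, h => absurd rfl (h s)
  | 1 :: 0 :: 1 :: s, p, hn, _ => .inr (hf.blocked p s 0 (by simp at hn; omega))
  | 1 :: 0 :: 0 :: w, p, hn, _ => by
    by_cases hw : ∃ s, w = 1 :: 1 :: s
    · obtain ⟨s, rfl⟩ := hw
      exact .inr (hf.one_zero_zero_one_one hlam p s (by simp at hn; omega))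
    · rcases hf.exists_tail_or_eq_zero hlam w (p ++ [1, 0, 0]) (by simp at hn ⊢; omega)
        (by simpa using hw) with ⟨D, hD, rfl⟩ | h
      · exact .inl ⟨_, .monomer hD, rfl⟩
      · exact .inr (by simpa using h)
  | [0, 1, 1], _, _, _ => .inl ⟨_, .rightDimer, rfl⟩
  | [0, 1, 1, 0], _, _, _ => .inl ⟨_, .truncDimer1, rfl⟩
  | [0, 1, 1, 0, 0], _, _, _ => .inl ⟨_, .truncDimer2, rfl⟩
  | 0 :: 1 :: 1 :: 1 :: s, p, hn, _ => .inr (by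
      have h := hf.blocked (p ++ [0]) s 1 (by simp at hn ⊢; omega)
      simpa only [List.append_assoc, List.cons_append, List.nil_append] using h)
  | 0 :: 1 :: 1 :: 0 :: 1 :: s, p, hn, _ => .inr (by
      have h := hf.blocked (p ++ [0, 1]) s 0 (by simp at hn ⊢; omega)
      simpa only [List.append_assoc, List.cons_append, List.nil_append] using h)
  | 0 :: 1 :: 1 :: 0 :: 0 :: 1 :: s, p, hn, _ =>
    .inr (hf.zero_one_one_zero_zero_one p s (by simp at hn; omega))
  | 0 :: 1 :: 1 :: 0 :: 0 :: 0 :: w, p, hn, _ => by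
    by_cases hw : ∃ s, w = 1 :: 1 :: s
    · obtain ⟨s, rfl⟩ := hw
      -- `01100011` hops to `10010011`, which ends in `10011`.
      have h1 := hf.hop p (0 :: 0 :: 1 :: 1 :: s) (by simp at hn ⊢; omega)
      have h2 := hf.one_zero_zero_one_one hlam (p ++ [1, 0, 0]) s (by simp at hn ⊢; omega)
      simp only [List.append_assoc, List.cons_append, List.nil_append] at h2
      exact .inr (by rw [h1, h2, mul_zero])
    · rcases hf.exists_tail_or_eq_zero hlam w (p ++ [0, 1, 1, 0, 0, 0])
        (by simp at hn ⊢; omega) (by simpa using hw) with ⟨D, hD, rfl⟩ | h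
      · exact .inl ⟨_, .dimer hD, rfl⟩
      · exact .inr (by simpa using h)
  | [0], _, _, _ => .inl ⟨_, .void .nil, rfl⟩
  | [0, 1], _, _, _ => .inl ⟨_, .void .rightMonomer1, rfl⟩
  | 0 :: 0 :: w, p, hn, _ => by
    rcases hf.exists_tail_or_eq_zero hlam (0 :: w) (p ++ [0]) (by simp at hn ⊢; omega)
      (by simp) with ⟨D, hD, h⟩ | h
    · exact .inl ⟨_, .void hD, by simp [Tile.bits, h]⟩
    · exact .inr (by simpa using h)
  | 0 :: 1 :: 0 :: w, p, hn, _ => by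
    rcases hf.exists_tail_or_eq_zero hlam (1 :: 0 :: w) (p ++ [0]) (by simp at hn ⊢; omega)
      (by simp) with ⟨D, hD, h⟩ | h
    · exact .inl ⟨_, .void hD, by simp [Tile.bits, h]⟩
    · exact .inr (by simpa using h)
termination_by w => w.length

/-- On at least five sites, only tiled configurations and `1100011` carry amplitude. -/
theorem exists_vmd_or_eq_zero (hf : IsZeroEnergy lam n f) (hlam : lam ≠ 0) (hn : 5 ≤ n)
    (w : List (Fin 2)) (hw : w.length = n) :
    (∃ D, IsVMD D ∧ tilingWord D = w) ∨ w = [1, 1, 0, 0, 0, 1, 1] ∨ f w = 0 := by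
  by_cases h : ∃ s, w = 1 :: 1 :: s
  swap
  · rcases hf.exists_tail_or_eq_zero hlam w [] (by simpa using hw) (by simpa using h) with
      ⟨D, hD, h⟩ | h
    · exact .inl ⟨D, .tail hD, h⟩
    · exact .inr (.inr h)
  obtain ⟨s, rfl⟩ := h
  match s with
  | [] | [_] | [_, _] => simp at hw; omega
  | 1 :: s => exact .inr (.inr (hf.blocked [] s 1 (by simp at hw ⊢; omega)))
  | 0 :: 1 :: s => exact .inr (.inr (hf.blocked [1] s 0 (by simp at hw ⊢; omega)))
  | 0 :: 0 :: 1 :: s =>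
    exact .inr (.inr (hf.one_one_zero_zero_one hlam [] s (by simp at hw ⊢; omega)))
  | [0, 0, 0, 1, 1] => exact .inr (.inl rfl)
  | 0 :: 0 :: 0 :: 1 :: 1 :: 1 :: s =>
    exact .inr (.inr (hf.blocked [1, 1, 0, 0, 0] s 1 (by simp at hw ⊢; omega)))
  | 0 :: 0 :: 0 :: 1 :: 1 :: 0 :: s =>
    -- `11000110` hops to `11001001`, which starts with `11001`.
    have h1 := hf.hop [1, 1, 0, 0] s (by simp at hw ⊢; omega)
    have h2 := hf.one_one_zero_zero_one hlam [] (0 :: 0 :: 1 :: s) (by simp at hw ⊢; omega)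
    simp only [List.cons_append, List.nil_append] at h1 h2
    exact .inr (.inr (by rw [h1, h2, mul_zero]))
  | [0, 0, 0] => exact .inl ⟨_, .left .nil, rfl⟩
  | [0, 0, 0, 1] => exact .inl ⟨_, .left .rightMonomer1, rfl⟩
  | 0 :: 0 :: 0 :: 0 :: s =>
    rcases hf.exists_tail_or_eq_zero hlam (0 :: s) [1, 1, 0, 0, 0] (by simp at hw ⊢; omega)
      (by simp) with ⟨D, hD, h⟩ | h
    · exact .inl ⟨_, .left hD, by rw [tilingWord_cons, h]; rfl⟩
    · exact .inr (.inr h)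
  | 0 :: 0 :: 0 :: 1 :: 0 :: s =>
    rcases hf.exists_tail_or_eq_zero hlam (1 :: 0 :: s) [1, 1, 0, 0, 0] (by simp at hw ⊢; omega)
      (by simp) with ⟨D, hD, h⟩ | h
    · exact .inl ⟨_, .left hD, by rw [tilingWord_cons, h]; rfl⟩
    · exact .inr (.inr h)

end IsZeroEnergy

/-! ### Configurations as words -/

/-- The configuration on `[a, b]` whose occupation numbers, read from left to right, are the
letters of `w`. -/
def wordConfig (a b : ℤ) (w : List (Fin 2)) : Config a b := fun y => w.getD (y.1 - a).toNat 0

theorem wordConfig_apply {a b : ℤ} (p s : List (Fin 2)) (e : Fin 2) {y : Set.Icc a b}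
    (hy : y.1 = a + p.length) : wordConfig a b (p ++ e :: s) y = e := by
  simp [wordConfig, hy]

theorem update_wordConfig {a b : ℤ} (p s : List (Fin 2)) (e v : Fin 2) {y : Set.Icc a b}
    (hy : y.1 = a + p.length) :
    Function.update (wordConfig a b (p ++ e :: s)) y v = wordConfig a b (p ++ v :: s) := by
  ext1 z
  by_cases h : z = y
  · subst h
    rw [Function.update_self, wordConfig_apply p s v hy]
  · rw [Function.update_of_ne h]
    have h1 := z.2.1
    have h2 : z.1 ≠ y.1 := fun h' => h (Subtype.ext h')
    simp only [wordConfig, List.getD_eq_getElem?_getD, List.getElem?_append]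
    split
    · rfl
    · obtain ⟨k, hk⟩ : ∃ k, (z.1 - a).toNat - p.length = k + 1 :=
        ⟨(z.1 - a).toNat - p.length - 1, by omega⟩
      simp [hk]

theorem exists_wordConfig {a b : ℤ} {n : ℕ} (hn : (n : ℤ) = b - a + 1) (σ : Config a b) :
    ∃ w : List (Fin 2), w.length = n ∧ wordConfig a b w = σ := by
  refine ⟨List.ofFn fun i : Fin n => σ ⟨a + i, by constructor <;> omega⟩, by simp, ?_⟩
  ext1 y
  obtain ⟨y, h1, h2⟩ := y
  have h3 : (y - a).toNat < n := by omega
  have h4 : a + max (y - a) 0 = y := by omega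
  simp [wordConfig, h3, h4]

theorem wordConfig_inj {a b : ℤ} {w w' : List (Fin 2)} (hw : (w.length : ℤ) = b - a + 1)
    (hw' : (w'.length : ℤ) = b - a + 1) : wordConfig a b w = wordConfig a b w' ↔ w = w' := by
  refine ⟨fun h => List.ext_getElem (by omega) fun i h1 h2 => ?_, fun h => h ▸ rfl⟩
  have := congrFun h ⟨a + i, by constructor <;> omega⟩
  simpa [wordConfig, h1, h2] using this

/-! ### The local operators in the occupation basis -/

theorem onSite_apply {a b : ℤ} (x : Set.Icc a b) (A : Matrix (Fin 2) (Fin 2) ℂ) (ψ : Hilb a b)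
    (σ : Config a b) : onSite x A ψ σ =
      A (σ x) 0 * ψ (Function.update σ x 0) + A (σ x) 1 * ψ (Function.update σ x 1) := by
  simp [onSite, Fin.sum_univ_two]

section
variable {a b : ℤ} {x : ℤ}

theorem siteOp_eq (hx : x ∈ Set.Icc a b) (A : Matrix (Fin 2) (Fin 2) ℂ) :
    siteOp a b x A = onSite ⟨x, hx⟩ A := dif_pos hx

theorem numOp_apply (hx : x ∈ Set.Icc a b) (ψ : Hilb a b) (σ : Config a b) :
    numOp a b x ψ σ = if σ ⟨x, hx⟩ = 1 then ψ σ else 0 := by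
  have h : onSite ⟨x, hx⟩ !![-1, 0; 0, 1] ψ σ = if σ ⟨x, hx⟩ = 1 then ψ σ else - ψ σ := by
    rw [onSite_apply]
    rcases Fin.exists_fin_two.mp ⟨_, (rfl : σ ⟨x, hx⟩ = _)⟩ with h | h
    · rw [h, ← h, Function.update_eq_self]; simp [h]
    · rw [h, ← h, Function.update_eq_self]; simp [h]
  have h' : numOp a b x ψ σ = (1 / 2 : ℂ) * (onSite ⟨x, hx⟩ !![-1, 0; 0, 1] ψ σ + ψ σ) := by
    simp [numOp, pauliZ, siteOp_eq hx, mul_add]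
  rw [h', h]
  split <;> ring

theorem numOp_mul_apply {x' : ℤ} (hx : x ∈ Set.Icc a b) (hx' : x' ∈ Set.Icc a b) (ψ : Hilb a b)
    (σ : Config a b) : (numOp a b x * numOp a b x') ψ σ =
      if σ ⟨x, hx⟩ = 1 ∧ σ ⟨x', hx'⟩ = 1 then ψ σ else 0 := by
  rw [Module.End.mul_apply, numOp_apply hx, numOp_apply hx', ite_and]

theorem lowerOp_apply (hx : x ∈ Set.Icc a b) (ψ : Hilb a b) (p s : List (Fin 2)) (e : Fin 2)
    (hp : x = a + p.length) : lowerOp a b x ψ (wordConfig a b (p ++ e :: s)) =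
      if e = 0 then ψ (wordConfig a b (p ++ 1 :: s)) else 0 := by
  rw [lowerOp, siteOp_eq hx, onSite_apply, wordConfig_apply p s e hp, update_wordConfig p s e _ hp,
    update_wordConfig p s e _ hp]
  fin_cases e <;> simp

/-- A configuration with a vacant site `x` is raised to the one with `x` occupied. -/
theorem raiseOp_ket (hx : x ∈ Set.Icc a b) (p s : List (Fin 2)) (hp : x = a + p.length) :
    raiseOp a b x (ket (wordConfig a b (p ++ 0 :: s))) = ket (wordConfig a b (p ++ 1 :: s)) := by
  ext σ
  rw [raiseOp, siteOp_eq hx, onSite_apply]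
  have h0 := wordConfig_apply p s 0 (y := ⟨x, hx⟩) hp
  have h1 := wordConfig_apply p s 1 (y := ⟨x, hx⟩) hp
  have hu := update_wordConfig p s 0 1 (y := ⟨x, hx⟩) hp
  have hu' := update_wordConfig p s 1 0 (y := ⟨x, hx⟩) hp
  simp only [ket, PiLp.single_apply]
  have key : (σ ⟨x, hx⟩ = 1 ∧ Function.update σ ⟨x, hx⟩ 0 = wordConfig a b (p ++ 0 :: s)) ↔
      σ = wordConfig a b (p ++ 1 :: s) := by
    constructor
    · rintro ⟨h, h'⟩
      rw [← hu, ← h', Function.update_idem, ← h, Function.update_eq_self]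
    · rintro rfl
      exact ⟨h1, hu'⟩
  by_cases h : σ ⟨x, hx⟩ = 1
  · simp only [h, true_and] at key
    simp [h, key]
  · have h2 : σ ⟨x, hx⟩ = 0 := by omega
    have h3 : σ ≠ wordConfig a b (p ++ 1 :: s) := fun h' => h (key.2 h').1
    simp [h2, h3]

theorem qOp_apply (lam : ℂ) (ψ : Hilb a b) (p s : List (Fin 2)) (e₀ e₁ e₂ e₃ : Fin 2)
    (hx : a ≤ x) (hx' : x + 3 ≤ b) (hp : x = a + p.length) :
    qOp lam a b x ψ (wordConfig a b (p ++ e₀ :: e₁ :: e₂ :: e₃ :: s)) =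
      (if e₁ = 0 ∧ e₂ = 0 then ψ (wordConfig a b (p ++ e₀ :: 1 :: 1 :: e₃ :: s)) else 0) -
      lam * if e₀ = 0 ∧ e₃ = 0 then ψ (wordConfig a b (p ++ 1 :: e₁ :: e₂ :: 1 :: s)) else 0 := by
  have m0 : x ∈ Set.Icc a b := ⟨by omega, by omega⟩
  have m1 : x + 1 ∈ Set.Icc a b := ⟨by omega, by omega⟩
  have m2 : x + 2 ∈ Set.Icc a b := ⟨by omega, by omega⟩
  have m3 : x + 3 ∈ Set.Icc a b := ⟨by omega, by omega⟩
  have h1 := lowerOp_apply m1 (lowerOp a b (x + 2) ψ) (p ++ [e₀]) (e₂ :: e₃ :: s) e₁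
    (by simp; omega)
  have h2 := lowerOp_apply m2 ψ (p ++ [e₀, 1]) (e₃ :: s) e₂ (by simp; omega)
  have h3 := lowerOp_apply m0 (lowerOp a b (x + 3) ψ) p (e₁ :: e₂ :: e₃ :: s) e₀ hp
  have h4 := lowerOp_apply m3 ψ (p ++ [1, e₁, e₂]) s e₃ (by simp; omega)
  simp only [List.append_assoc, List.cons_append, List.nil_append] at h1 h2 h3 h4
  simp only [qOp, LinearMap.sub_apply, LinearMap.smul_apply, Module.End.mul_apply, PiLp.sub_apply,
    PiLp.smul_apply, smul_eq_mul, h1, h2, h3, h4, ite_and]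

end

/-! ### Zero-energy states -/

/-- `n_x n_{x'}` is an orthogonal projection, so that its expectation value in `ψ` vanishes only
if it annihilates `ψ`. -/
theorem inner_numOp_mul {a b x x' : ℤ} (hx : x ∈ Set.Icc a b) (hx' : x' ∈ Set.Icc a b)
    (ψ : Hilb a b) : inner ℂ ψ ((numOp a b x * numOp a b x') ψ) =
      ((‖(numOp a b x * numOp a b x') ψ‖ ^ 2 : ℝ) : ℂ) := by
  have h : inner ℂ ψ ((numOp a b x * numOp a b x') ψ) =
      inner ℂ ((numOp a b x * numOp a b x') ψ) ((numOp a b x * numOp a b x') ψ) := by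
    simp only [PiLp.inner_apply, numOp_mul_apply hx hx']
    refine Finset.sum_congr rfl fun σ _ => ?_
    split <;> simp
  rw [h, inner_self_eq_norm_sq_to_K]
  simp

/-- Since the Hamiltonian is a sum of nonnegative terms, it annihilates exactly the vectors that
every single term annihilates. -/
theorem mem_ker_hamiltonian_iff {lam : ℂ} {κ : ℝ} (hκ : 0 < κ) {a b : ℤ} (ψ : Hilb a b) :
    ψ ∈ LinearMap.ker (hamiltonian lam κ a b) ↔
      (∀ x ∈ Finset.Icc a (b - 2), (numOp a b x * numOp a b (x + 2)) ψ = 0) ∧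
      (∀ x ∈ Finset.Icc a (b - 3), qOp lam a b x ψ = 0) := by
  rw [LinearMap.mem_ker]
  constructor
  · intro h
    have h0 : inner ℂ ψ (hamiltonian lam κ a b ψ) = 0 := by rw [h, inner_zero_right]
    have h1 : inner ℂ ψ (hamiltonian lam κ a b ψ) =
        ((∑ x ∈ Finset.Icc a (b - 2), ‖(numOp a b x * numOp a b (x + 2)) ψ‖ ^ 2 +
          κ * ∑ x ∈ Finset.Icc a (b - 3), ‖qOp lam a b x ψ‖ ^ 2 : ℝ) : ℂ) := by
      simp only [hamiltonian, LinearMap.add_apply, LinearMap.smul_apply, LinearMap.sum_apply,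
        inner_add_right, inner_smul_right, inner_sum]
      push_cast
      congr 1
      · refine Finset.sum_congr rfl fun x hx => ?_
        rw [Finset.mem_Icc] at hx
        rw [inner_numOp_mul ⟨by omega, by omega⟩ ⟨by omega, by omega⟩]
        push_cast; rfl
      · congr 1
        refine Finset.sum_congr rfl fun x hx => ?_
        rw [Module.End.mul_apply, LinearMap.adjoint_inner_right, inner_self_eq_norm_sq_to_K]
        simp
    rw [h1, Complex.ofReal_eq_zero] at h0
    have p1 : 0 ≤ ∑ x ∈ Finset.Icc a (b - 2), ‖(numOp a b x * numOp a b (x + 2)) ψ‖ ^ 2 :=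
      Finset.sum_nonneg fun _ _ => by positivity
    have p2 : 0 ≤ ∑ x ∈ Finset.Icc a (b - 3), ‖qOp lam a b x ψ‖ ^ 2 :=
      Finset.sum_nonneg fun _ _ => by positivity
    have p3 := mul_nonneg hκ.le p2
    have e1 := (Finset.sum_eq_zero_iff_of_nonneg fun _ _ => by positivity).1
      (show ∑ x ∈ Finset.Icc a (b - 2), ‖(numOp a b x * numOp a b (x + 2)) ψ‖ ^ 2 = 0 by linarith)
    have e2 := (Finset.sum_eq_zero_iff_of_nonneg fun _ _ => by positivity).1
      ((mul_eq_zero.1 (show κ * ∑ x ∈ Finset.Icc a (b - 3), ‖qOp lam a b x ψ‖ ^ 2 = 0 by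
        linarith)).resolve_left hκ.ne')
    exact ⟨fun x hx => by simpa using e1 x hx, fun x hx => by simpa using e2 x hx⟩
  · rintro ⟨h1, h2⟩
    simp only [hamiltonian, LinearMap.add_apply, LinearMap.smul_apply, LinearMap.sum_apply]
    rw [Finset.sum_eq_zero h1, Finset.sum_eq_zero fun x hx => ?_, smul_zero, add_zero]
    rw [Module.End.mul_apply, h2 x hx, map_zero]

theorem exists_eq_append_append {α : Type*} (w : List α) (k m : ℕ) (h : k + m ≤ w.length) :
    ∃ p t s : List α, p.length = k ∧ t.length = m ∧ w = p ++ (t ++ s) :=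
  ⟨w.take k, (w.drop k).take m, (w.drop k).drop m, by simp; omega, by simp; omega, by simp⟩

/-- The kernel of the Hamiltonian is described by the local constraints on the amplitudes. -/
theorem mem_ker_hamiltonian_iff_isZeroEnergy {lam : ℂ} {κ : ℝ} (hκ : 0 < κ) {a b : ℤ} {n : ℕ}
    (hn : (n : ℤ) = b - a + 1) (ψ : Hilb a b) :
    ψ ∈ LinearMap.ker (hamiltonian lam κ a b) ↔
      IsZeroEnergy lam n fun w => ψ (wordConfig a b w) := by
  rw [mem_ker_hamiltonian_iff hκ]
  constructor
  · rintro ⟨h1, h2⟩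
    refine ⟨fun p s u hl => ?_, fun p s hl => ?_⟩
    · have h := congrArg (fun φ : Hilb a b => φ (wordConfig a b (p ++ 1 :: u :: 1 :: s)))
        (h1 (a + p.length) (by rw [Finset.mem_Icc]; omega))
      have e := wordConfig_apply (p ++ [1, u]) s 1
        (y := (⟨a + p.length + 2, by omega, by omega⟩ : Set.Icc a b)) (by simp; omega)
      simp only [List.append_assoc, List.cons_append, List.nil_append] at e
      rw [numOp_mul_apply ⟨by omega, by omega⟩ ⟨by omega, by omega⟩,
        wordConfig_apply p _ 1 rfl, e] at h
      simpa using h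
    · have h := congrArg (fun φ : Hilb a b => φ (wordConfig a b (p ++ 0 :: 0 :: 0 :: 0 :: s)))
        (h2 (a + p.length) (by rw [Finset.mem_Icc]; omega))
      rw [qOp_apply lam ψ p s 0 0 0 0 (by omega) (by omega) rfl] at h
      simpa [sub_eq_zero] using h
  · rintro ⟨h1, h2⟩
    constructor
    · intro x hx
      rw [Finset.mem_Icc] at hx
      ext σ
      obtain ⟨w, hw, rfl⟩ := exists_wordConfig hn σ
      obtain ⟨p, t, s, hp, ht, rfl⟩ := exists_eq_append_append w (x - a).toNat 3 (by omega)
      match t, ht with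
      | [e₀, e₁, e₂], _ =>
        have hp' : x = a + p.length := by omega
        have e := wordConfig_apply (p ++ [e₀, e₁]) s e₂
          (y := (⟨x + 2, by omega, by omega⟩ : Set.Icc a b)) (by simp; omega)
        simp only [List.append_assoc, List.cons_append, List.nil_append] at e ⊢
        rw [numOp_mul_apply ⟨by omega, by omega⟩ ⟨by omega, by omega⟩,
          wordConfig_apply p _ e₀ hp', e]
        split
        · rename_i h
          obtain ⟨rfl, rfl⟩ := h
          exact h1 p s e₁ (by simp at hw; omega)
        · rfl
    · intro x hx
      rw [Finset.mem_Icc] at hx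
      ext σ
      obtain ⟨w, hw, rfl⟩ := exists_wordConfig hn σ
      obtain ⟨p, t, s, hp, ht, rfl⟩ := exists_eq_append_append w (x - a).toNat 4 (by omega)
      match t, ht with
      | [e₀, e₁, e₂, e₃], _ =>
        have hp' : x = a + p.length := by omega
        simp only [List.length_append, List.length_cons, List.length_nil] at hw
        simp only [List.cons_append, List.nil_append]
        rw [qOp_apply lam ψ p s e₀ e₁ e₂ e₃ hx.1 (by omega) hp', PiLp.zero_apply]
        -- Only the empty pattern `0000` gives a condition that is not already a blocked one.
        have k1 : ψ (wordConfig a b (p ++ 1 :: 1 :: 1 :: e₃ :: s)) = 0 :=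
          h1 p (e₃ :: s) 1 (by simp; omega)
        have k2 : ψ (wordConfig a b (p ++ e₀ :: 1 :: 1 :: 1 :: s)) = 0 := by
          have h := h1 (p ++ [e₀]) s 1 (by simp; omega)
          simpa only [List.append_assoc, List.cons_append, List.nil_append] using h
        have k3 : ψ (wordConfig a b (p ++ 1 :: e₁ :: 1 :: 1 :: s)) = 0 :=
          h1 p (1 :: s) e₁ (by simp; omega)
        have k4 : ψ (wordConfig a b (p ++ 1 :: 1 :: e₂ :: 1 :: s)) = 0 := by
          have h := h1 (p ++ [1]) s e₂ (by simp; omega)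
          simpa only [List.append_assoc, List.cons_append, List.nil_append] using h
        have k5 := h2 p s (by omega)
        have hbit : ∀ e : Fin 2, e = 0 ∨ e = 1 := by decide
        rcases hbit e₀ with rfl | rfl <;> rcases hbit e₁ with rfl | rfl <;>
          rcases hbit e₂ with rfl | rfl <;> rcases hbit e₃ with rfl | rfl <;>
          simp [k1, k2, k3, k4, k5]

/-! ### The amplitudes of the VMD states -/

section
variable {lam : ℂ} {a b : ℤ}

theorem tileOp_ket (T : Tile) {x : ℤ} (p s : List (Fin 2)) (hx : x = a + p.length)
    (hb : x + T.size ≤ b + 1) :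
    tileOp lam a b x T (ket (wordConfig a b (p ++ (List.replicate T.size 0 ++ s)))) =
      lam ^ T.weight • ket (wordConfig a b (p ++ (T.bits ++ s))) := by
  have mono (s : List (Fin 2)) (h : x ≤ b) := raiseOp_ket (b := b) ⟨by omega, h⟩ p s hx
  have pair (q s : List (Fin 2)) (y : ℤ) (hy : y = a + q.length) (h : y + 1 ≤ b) :
      raiseOp a b y (raiseOp a b (y + 1) (ket (wordConfig a b (q ++ 0 :: 0 :: s)))) =
        ket (wordConfig a b (q ++ 1 :: 1 :: s)) := by
    have h1 := raiseOp_ket (a := a) (b := b) (x := y + 1) ⟨by omega, h⟩ (q ++ [0]) s (by simp; omega)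
    simp only [List.append_assoc, List.cons_append, List.nil_append] at h1
    rw [h1, raiseOp_ket (b := b) (x := y) ⟨by omega, by omega⟩ q _ hy]
  have middle (s : List (Fin 2)) (h : x + 2 ≤ b) :
      raiseOp a b (x + 1) (raiseOp a b (x + 2) (ket (wordConfig a b (p ++ 0 :: 0 :: 0 :: s)))) =
        ket (wordConfig a b (p ++ 0 :: 1 :: 1 :: s)) := by
    have h1 := pair (p ++ [0]) s (x + 1) (by simp; omega) (by omega)
    simpa only [List.append_assoc, List.cons_append, List.nil_append, add_assoc,
      Int.reduceAdd] using h1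
  cases T <;> simp only [Tile.size, Nat.cast_ofNat, Nat.cast_one] at hb <;>
    simp only [tileOp, Tile.size, Tile.weight, Tile.bits, List.replicate, List.cons_append,
      List.nil_append, pow_zero, pow_one, one_smul, Module.End.one_apply, LinearMap.smul_apply,
      Module.End.mul_apply]
  case leftDimer => rw [pair p _ x hx (by omega)]
  case monomer | rightMonomer1 | rightMonomer2 => exact mono _ (by omega)
  all_goals rw [middle _ (by omega)]

theorem tilingOp_ket (D : List Tile) {x : ℤ} (p : List (Fin 2)) (hx : x = a + p.length)
    (hb : x + tilingSize D = b + 1) :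
    tilingOp lam a b x D (ket (wordConfig a b (p ++ List.replicate (tilingSize D) 0))) =
      lam ^ dimerCount D • ket (wordConfig a b (p ++ tilingWord D)) := by
  induction D generalizing x p with
  | nil => simp [tilingOp]
  | cons T D ih =>
    simp only [tilingSize_cons, Nat.cast_add] at hb
    have h := ih (p ++ List.replicate T.size 0) (x := x + T.size) (by simp; omega) (by omega)
    rw [List.append_assoc, List.append_assoc, ← List.replicate_add] at h
    rw [tilingOp, Module.End.mul_apply, tilingSize_cons, h, map_smul,
      tileOp_ket T p _ hx (by omega), smul_smul, dimerCount_cons, tilingWord_cons, pow_add, mul_comm]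

theorem vmdState_apply_word (R : RootTiling a b) (w : List (Fin 2))
    (hw : (w.length : ℤ) = b - a + 1) : vmdState lam R (wordConfig a b w) =
      ∑ D ∈ vmdTilings R.1, if w = tilingWord D then lam ^ dimerCount D else 0 := by
  rw [vmdState, WithLp.ofLp_sum, Finset.sum_apply]
  refine Finset.sum_congr rfl fun D hD => ?_
  have hs : (tilingSize D : ℤ) = b - a + 1 := by
    rw [← tilingSize_rootOf, (mem_vmdTilings R.2).1 hD]
    exact R.2.isVMD.2.2
  have h0 : (fun _ => 0 : Config a b) =
      wordConfig a b ([] ++ List.replicate (tilingSize D) 0) := by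
    ext1 y
    simp [wordConfig, List.getElem?_replicate]
    split <;> rfl
  rw [h0, tilingOp_ket D [] (by simp) (by omega), PiLp.smul_apply, ket, PiLp.single_apply,
    smul_eq_mul, List.nil_append]
  simp [wordConfig_inj hw (by rw [length_tilingWord, hs])]

/-- A VMD state takes the value `lam ^ dimerCount D` at each of the tilings `D` derived from its
root, and `0` at all other tilings. -/
theorem vmdState_apply_tilingWord (R : RootTiling a b) {D : List Tile} (hD : IsVMD D)
    (hs : (tilingSize D : ℤ) = b - a + 1) : vmdState lam R (wordConfig a b (tilingWord D)) =
      if rootOf D = R.1 then lam ^ dimerCount D else 0 := by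
  rw [vmdState_apply_word R _ (by rw [length_tilingWord, hs])]
  have key : ∀ E ∈ vmdTilings R.1, tilingWord D = tilingWord E ↔ D = E := fun E hE =>
    ⟨hD.word_inj (IsVMD.of_rootOf ((mem_vmdTilings R.2).1 hE ▸ R.2.isVMD.1)), congrArg _⟩
  rw [Finset.sum_congr rfl fun E hE => if_congr (key E hE) rfl rfl, Finset.sum_ite_eq]
  simp only [mem_vmdTilings R.2]

theorem vmdState_apply_eq_zero (R : RootTiling a b) (w : List (Fin 2))
    (hw : (w.length : ℤ) = b - a + 1) (h : ∀ D, IsVMD D → tilingWord D ≠ w) :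
    vmdState lam R (wordConfig a b w) = 0 := by
  rw [vmdState_apply_word R w hw]
  refine Finset.sum_eq_zero fun D hD => if_neg fun h' => ?_
  exact h D (IsVMD.of_rootOf ((mem_vmdTilings R.2).1 hD ▸ R.2.isVMD.1)) h'.symm

theorem isZeroEnergy_vmdState {n : ℕ} (hn : (n : ℤ) = b - a + 1) (R : RootTiling a b) :
    IsZeroEnergy lam n fun w => vmdState lam R (wordConfig a b w) := by
  refine ⟨fun p s u hl => ?_, fun p s hl => ?_⟩
  · exact vmdState_apply_eq_zero R _ (by simp; omega) fun D hD => hD.word_ne_blocked p s u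
  · have hl₁ : ((p ++ 0 :: 1 :: 1 :: 0 :: s).length : ℤ) = b - a + 1 := by simp; omega
    have hl₂ : ((p ++ 1 :: 0 :: 0 :: 1 :: s).length : ℤ) = b - a + 1 := by simp; omega
    by_cases h : ∃ D, IsVMD D ∧ tilingWord D = p ++ 0 :: 1 :: 1 :: 0 :: s
    · obtain ⟨D, hD, hw⟩ := h
      obtain ⟨E, hE, hr, hc, hw'⟩ := hD.exists_unsubst p s hw
      simp only
      rw [← hw, length_tilingWord] at hl₁
      rw [← hw', length_tilingWord] at hl₂
      rw [← hw, ← hw', vmdState_apply_tilingWord R hD hl₁, vmdState_apply_tilingWord R hE hl₂, hr,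
        hc, pow_succ']
      split <;> simp
    · have h' : ∀ D, IsVMD D → tilingWord D ≠ p ++ 1 :: 0 :: 0 :: 1 :: s := fun D hD hw =>
        h (hD.exists_subst p s hw)
      simp only
      rw [vmdState_apply_eq_zero R _ hl₁ (by simpa using h), vmdState_apply_eq_zero R _ hl₂ h',
        mul_zero]

/-- VMD states of different roots have disjoint supports. -/
theorem inner_vmdState (R R' : RootTiling a b) (hR : R ≠ R') :
    inner ℂ (vmdState lam R) (vmdState lam R') = 0 := by
  obtain ⟨n, hn⟩ : ∃ n : ℕ, (n : ℤ) = b - a + 1 := ⟨_, R.2.isVMD.2.2⟩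
  rw [PiLp.inner_apply]
  refine Finset.sum_eq_zero fun σ _ => ?_
  obtain ⟨w, hw, rfl⟩ := exists_wordConfig hn σ
  have hl : (w.length : ℤ) = b - a + 1 := by omega
  by_cases h : ∃ D, IsVMD D ∧ tilingWord D = w
  · obtain ⟨D, hD, rfl⟩ := h
    rw [length_tilingWord] at hl
    rw [vmdState_apply_tilingWord R hD hl, vmdState_apply_tilingWord R' hD hl]
    by_cases h : rootOf D = R.1
    · have h' : rootOf D ≠ R'.1 := fun h' => hR (Subtype.ext (h.symm.trans h'))
      simp [h']
    · simp [h]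
  · rw [vmdState_apply_eq_zero R w hl (by simpa using h)]
    simp

theorem vmdState_apply_root (R : RootTiling a b) :
    vmdState lam R (wordConfig a b (tilingWord R.1)) = lam ^ dimerCount R.1 := by
  obtain ⟨h1, h2, h3⟩ := R.2.isVMD
  rw [vmdState_apply_tilingWord R h1 h3, if_pos h2]

theorem vmdState_ne_zero (hlam : lam ≠ 0) (R : RootTiling a b) : vmdState lam R ≠ 0 := by
  intro h
  have h' := vmdState_apply_root (lam := lam) R
  rw [h, PiLp.zero_apply] at h'
  exact pow_ne_zero _ hlam h'.symm

theorem linearIndependent_vmdState (hlam : lam ≠ 0) :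
    LinearIndependent ℂ fun R : RootTiling a b => vmdState lam R :=
  linearIndependent_of_ne_zero_of_inner_eq_zero (vmdState_ne_zero hlam)
    fun R R' h => inner_vmdState R R' h

/-! ### The kernel of the Hamiltonian -/

/-- The amplitude of a zero-energy state at a tiling is determined by the one at its root. -/
theorem IsZeroEnergy.apply_tilingWord {n : ℕ} {f : List (Fin 2) → ℂ} (hf : IsZeroEnergy lam n f)
    {R D : List Tile} (h : Relation.ReflTransGen Subst R D) (hs : tilingSize R = n) :
    f (tilingWord D) * lam ^ dimerCount R = lam ^ dimerCount D * f (tilingWord R) := by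
  have hsize {D E : List Tile} (h : Subst D E) : tilingSize E = tilingSize D := by
    rw [← tilingSize_rootOf, h.rootOf_eq, tilingSize_rootOf]
  have key : tilingSize D = n ∧
      f (tilingWord D) * lam ^ dimerCount R = lam ^ dimerCount D * f (tilingWord R) := by
    induction h with
    | refl => exact ⟨hs, mul_comm _ _⟩
    | tail _ h ih =>
      refine ⟨(hsize h).trans ih.1, ?_⟩
      obtain ⟨hn, ih⟩ := ih
      have step : ∀ (p : List Tile) (X Y : List Tile) (s : List (Fin 2)),
          tilingWord X = 1 :: 0 :: 0 :: 1 :: s → tilingWord Y = 0 :: 1 :: 1 :: 0 :: s →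
          dimerCount Y = dimerCount X + 1 → tilingSize (p ++ X) = n →
          f (tilingWord (p ++ X)) * lam ^ dimerCount R =
            lam ^ dimerCount (p ++ X) * f (tilingWord R) →
          f (tilingWord (p ++ Y)) * lam ^ dimerCount R =
            lam ^ dimerCount (p ++ Y) * f (tilingWord R) := by
        intro p X Y s hX hY hc hn ih
        have hl := length_tilingWord (p ++ X)
        rw [hn] at hl
        simp only [tilingWord, List.flatMap_append] at hX hY hl ih ⊢
        simp only [dimerCount, List.map_append, List.sum_append] at hc ih ⊢
        rw [hX] at hl ih
        rw [hY, hf.hop _ s (by simp at hl ⊢; omega), hc, mul_assoc, ih]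
        ring
      cases h with
      | basic p s =>
        rw [List.append_assoc] at hn ih ⊢
        exact step p _ _ (0 :: 0 :: tilingWord s) (by simp [Tile.bits]) (by simp [Tile.bits])
          (by simp [Tile.weight]; omega) hn ih
      | trunc1 p => exact step p _ _ [] rfl rfl rfl hn ih
      | trunc2 p => exact step p _ _ [0] rfl rfl rfl hn ih
  exact key.2

theorem finite_rootTiling (hlam : lam ≠ 0) : Finite (RootTiling a b) :=
  (linearIndependent_vmdState (a := a) (b := b) hlam).finite

/-- A zero-energy state agrees with a VMD vector outside of `1100011`. -/
theorem exists_vmdSpace_apply_eq (hlam : lam ≠ 0) {n : ℕ} (hn : (n : ℤ) = b - a + 1)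
    (h5 : 5 ≤ n) (ψ : Hilb a b) (hψ : IsZeroEnergy lam n fun w => ψ (wordConfig a b w)) :
    ∃ φ ∈ vmdSpace lam a b, ∀ w : List (Fin 2), w.length = n → w ≠ [1, 1, 0, 0, 0, 1, 1] →
      ψ (wordConfig a b w) = φ (wordConfig a b w) := by
  have := finite_rootTiling (a := a) (b := b) hlam
  have := Fintype.ofFinite (RootTiling a b)
  refine ⟨∑ R : RootTiling a b, (ψ (wordConfig a b (tilingWord R.1)) / lam ^ dimerCount R.1) •
    vmdState lam R, Submodule.sum_mem _ fun R _ => Submodule.smul_mem _ _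
      (Submodule.subset_span ⟨R, rfl⟩), fun w hw hne => ?_⟩
  have hl : (w.length : ℤ) = b - a + 1 := by omega
  simp only [WithLp.ofLp_sum, Finset.sum_apply, PiLp.smul_apply, smul_eq_mul]
  by_cases h : ∃ D, IsVMD D ∧ tilingWord D = w
  · obtain ⟨D, hD, rfl⟩ := h
    rw [length_tilingWord] at hl hw
    rw [Finset.sum_eq_single ⟨rootOf D, hD.isRootTiling_rootOf hl⟩]
    · rw [vmdState_apply_tilingWord _ hD hl, if_pos rfl, div_mul_eq_mul_div,
        eq_div_iff (pow_ne_zero _ hlam)]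
      exact (hψ.apply_tilingWord hD.substTilings (by rw [tilingSize_rootOf, hw])).trans
        (mul_comm _ _)
    · intro R _ hR
      rw [vmdState_apply_tilingWord R hD hl, if_neg fun h => hR (Subtype.ext h.symm), mul_zero]
    · simp
  · rw [(hψ.exists_vmd_or_eq_zero hlam h5 w hw).resolve_left h |>.resolve_left hne]
    refine (Finset.sum_eq_zero fun R _ => ?_).symm
    rw [vmdState_apply_eq_zero R w hl (by simpa using h), mul_zero]

theorem vmdSpace_le_ker {κ : ℝ} (hκ : 0 < κ) {n : ℕ} (hn : (n : ℤ) = b - a + 1) :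
    vmdSpace lam a b ≤ LinearMap.ker (hamiltonian lam κ a b) := by
  rw [vmdSpace, Submodule.span_le]
  rintro _ ⟨R, rfl⟩
  exact (mem_ker_hamiltonian_iff_isZeroEnergy hκ hn _).2 (isZeroEnergy_vmdState hn R)

/-! ### The additional state on seven sites -/

theorem extraKet_eq (h7 : b - a + 1 = 7) :
    extraKet a b = ket (wordConfig a b [1, 1, 0, 0, 0, 1, 1]) := by
  rw [extraKet]
  congr 1
  ext1 ⟨y, h1, h2⟩
  obtain ⟨k, rfl⟩ : ∃ k : ℕ, y = a + k := ⟨(y - a).toNat, by omega⟩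
  have hk : k < 7 := by omega
  simp only [wordConfig, add_sub_cancel_left, Int.toNat_natCast]
  interval_cases k <;> simp

theorem extraKet_apply (h7 : b - a + 1 = 7) (w : List (Fin 2)) (hw : w.length = 7) :
    extraKet a b (wordConfig a b w) = if w = [1, 1, 0, 0, 0, 1, 1] then 1 else 0 := by
  rw [extraKet_eq h7, ket, PiLp.single_apply]
  simp only [wordConfig_inj (a := a) (b := b) (w := w) (w' := [1, 1, 0, 0, 0, 1, 1])
    (by omega) (by simp; omega)]

theorem isZeroEnergy_extraKet (h7 : b - a + 1 = 7) :
    IsZeroEnergy lam 7 fun w => extraKet a b (wordConfig a b w) := by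
  refine ⟨fun p s u hl => ?_, fun p s hl => ?_⟩
  · simp only
    rw [extraKet_apply h7 _ (by simp; omega), if_neg]
    rcases p with _ | ⟨c0, _ | ⟨c1, _ | ⟨c2, _ | ⟨c3, _ | ⟨c4, p⟩⟩⟩⟩⟩ <;> simp at hl ⊢
    omega
  · simp only
    rw [extraKet_apply h7 _ (by simp; omega), extraKet_apply h7 _ (by simp; omega), if_neg,
      if_neg, mul_zero]
    all_goals
      rcases p with _ | ⟨c0, _ | ⟨c1, _ | ⟨c2, _ | ⟨c3, p⟩⟩⟩⟩ <;> simp at hl ⊢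
      omega

/-- The configuration `1100011` has no tiling: two particles next to each other at the left end
force a left dimer, and the remaining `11` is not the beginning of a tail. -/
theorem IsVMD.word_ne_extra {D : List Tile} (h : IsVMD D) :
    tilingWord D ≠ [1, 1, 0, 0, 0, 1, 1] := by
  cases h with
  | tail h => exact h.word_ne _
  | left h =>
    simp [Tile.bits]
    exact h.word_ne _

theorem vmdSpace_isOrtho_extraKet (h7 : b - a + 1 = 7) :
    vmdSpace lam a b ⟂ Submodule.span ℂ {extraKet a b} := by
  rw [vmdSpace, Submodule.isOrtho_span]
  rintro _ ⟨R, rfl⟩ _ rfl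
  rw [extraKet_eq h7, ket, EuclideanSpace.inner_single_right,
    vmdState_apply_eq_zero R _ (by simp; omega) fun D hD => hD.word_ne_extra]
  simp

end

theorem theorem2 (lam : ℂ) (hlam : lam ≠ 0) (κ : ℝ) (hκ : 0 < κ) (a b : ℤ)
    (hΛ : 5 ≤ b - a + 1) :
    ((b - a + 1 = 5 ∨ b - a + 1 = 6 ∨ 8 ≤ b - a + 1) →
      LinearMap.ker (hamiltonian lam κ a b) = vmdSpace lam a b) ∧
    (b - a + 1 = 7 →
      LinearMap.ker (hamiltonian lam κ a b) =
          vmdSpace lam a b ⊔ Submodule.span ℂ {extraKet a b} ∧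
        vmdSpace lam a b ⟂ Submodule.span ℂ {extraKet a b}) ∧
    (∃ B : Module.Basis (RootTiling a b) ℂ (vmdSpace lam a b),
      (∀ R : RootTiling a b, (B R : Hilb a b) = vmdState lam R) ∧
      ∀ R R' : RootTiling a b, R ≠ R' → inner ℂ (vmdState lam R) (vmdState lam R') = 0) := by
  obtain ⟨n, hn⟩ : ∃ n : ℕ, (n : ℤ) = b - a + 1 := ⟨(b - a + 1).toNat, by omega⟩
  refine ⟨fun h => ?_, fun h7 => ⟨?_, vmdSpace_isOrtho_extraKet h7⟩,
    Module.Basis.span (linearIndependent_vmdState hlam), fun R => ?_, inner_vmdState⟩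
  · refine le_antisymm (fun ψ hψ => ?_) (vmdSpace_le_ker hκ hn)
    obtain ⟨φ, hφ, he⟩ := exists_vmdSpace_apply_eq hlam hn (by omega) ψ
      ((mem_ker_hamiltonian_iff_isZeroEnergy hκ hn ψ).1 hψ)
    suffices ψ = φ from this ▸ hφ
    ext σ
    obtain ⟨w, hw, rfl⟩ := exists_wordConfig hn σ
    refine he w hw ?_
    rintro rfl
    simp at hw
    omega
  · obtain rfl : n = 7 := by omega
    refine le_antisymm (fun ψ hψ => ?_) (sup_le (vmdSpace_le_ker hκ hn) ?_)
    · obtain ⟨φ, hφ, he⟩ := exists_vmdSpace_apply_eq hlam hn (by omega) ψ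
        ((mem_ker_hamiltonian_iff_isZeroEnergy hκ hn ψ).1 hψ)
      refine Submodule.mem_sup.2 ⟨φ, hφ, _, Submodule.smul_mem _
        ((ψ - φ) (wordConfig a b [1, 1, 0, 0, 0, 1, 1])) (Submodule.mem_span_singleton_self _), ?_⟩
      ext σ
      obtain ⟨w, hw, rfl⟩ := exists_wordConfig hn σ
      rw [PiLp.add_apply, PiLp.smul_apply, extraKet_apply h7 w hw]
      by_cases h : w = [1, 1, 0, 0, 0, 1, 1]
      · simp [h]
      · simp [h, he w hw h]
    · rw [Submodule.span_singleton_le_iff_mem]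
      exact (mem_ker_hamiltonian_iff_isZeroEnergy hκ hn _).2 (isZeroEnergy_extraKet h7)
  · exact congrArg Subtype.val (Module.Basis.span_apply (linearIndependent_vmdState hlam) R)
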